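/- A digraph here is finite and may have loops and multiple arcs. A mixed graph $D=(V,A)$ is a digraph together with a partition $E(D)$ of its arc set $A$ into singletons (oriented edges) and doubletons made of two opposite arcs (unoriented edges). A complete orientation of $D$ is a digraph $\vec D$ obtained by choosing a direction for each unoriented edge, that is, by keeping exactly one arc of each doubleton (the two choices for an unoriented loop are counted as different); let $\mathrm{Ori}(D)$ denote the set of these choices. A digraph is totally cyclic if each of its arcs belongs to a directed cycle. Let $c(D)$ be the number of connected components of $D$. For a digraph $D=(V,A)$, let $B_D(q,y,z)$ be the unique polynomial such that, for every positive integer $q$, $$B_D(q,y,z)=\sum_{f:V\to\{1,\ldots,q\}}y^{\#\{(u,v)\in A\,:\,f(u)<f(v)\}}\,z^{\#\{(u,v)\in A\,:\,f(u)>f(v)\}},$$ where arcs are counted with multiplicity. For a mixed graph $D$ put $$T^{(2)}_D(x,y)=\frac{y^{|E(D)|}}{2^{|E(D)|}(y-1)^{|V|}(x-1)^{c(D)}}\sum_{\vec D\in \mathrm{Ori}(D)}B_{\vec D}\left((x-1)(y-1),\frac{2-y}{y},1\right).$$ Then, for every mixed graph $D$, the value of $T^{(2)}_D$ at $(x,y)=(0,2)$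 is $$T^{(2)}_D(0,2)=\#\{\text{totally cyclic complete orientations of } D\}.$$ -/

import Mathlib

/-- A directed graph on the vertex set `V` whose arcs are labelled by `A`; loops and multiple arcs
are allowed. -/
structure MultiDigraph (V A : Type*) where
  origin : A → V
  target : A → V

namespace MultiDigraph

variable {V A : Type*}

/-- The subdigraph with vertex set `V` that keeps exactly the arcs in `S`. -/
def restrict (D : MultiDigraph V A) (S : Finset A) : MultiDigraph V S where
  origin a := D.origin a
  target a := D.target a

/-- The number of ascents of a coloring `f`: arcs `(u, v)` with `f u < f v`. -/
def ascents [Fintype A] {C : Type*} [LinearOrder C] (D : MultiDigraph V A) (f : V → C) : ℕ :=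
  (Finset.univ.filter fun a => f (D.origin a) < f (D.target a)).card

/-- The number of descents of a coloring `f`: arcs `(u, v)` with `f v < f u`. -/
def descents [Fintype A] {C : Type*} [LinearOrder C] (D : MultiDigraph V A) (f : V → C) : ℕ :=
  (Finset.univ.filter fun a => f (D.target a) < f (D.origin a)).card

open Classical in
/-- The `B`-polynomial `B_D(q, y, z)` with `q = X 0`, `y = X 1`, `z = X 2`:
`∑ p, q (q - 1) ⋯ (q - p + 1) / p! * ∑ g, y ^ asc(g) * z ^ des(g)`, where `g` runs over the
surjections of `V` onto `p` linearly ordered colors. By `eval_bPoly` and `bPoly_unique` below, it is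
the unique polynomial that for every positive integer `q` is the generating function of the
`q`-colorings of `D` by ascents and descents. -/
noncomputable def bPoly [Fintype V] [Fintype A] (D : MultiDigraph V A) :
    MvPolynomial (Fin 3) ℚ :=
  ∑ p ∈ Finset.range (Fintype.card V + 1),
    MvPolynomial.C ((p.factorial : ℚ)⁻¹) *
      Polynomial.aeval (MvPolynomial.X 0 : MvPolynomial (Fin 3) ℚ) (descPochhammer ℚ p) *
      ∑ g ∈ (Finset.univ.filter fun g : V → Fin p => Function.Surjective g),
        MvPolynomial.X 1 ^ D.ascents g * MvPolynomial.X 2 ^ D.descents g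

lemma ascents_comp [Fintype A] {C C' : Type*} [LinearOrder C] [LinearOrder C']
    (D : MultiDigraph V A) (e : C ↪o C') (f : V → C) : D.ascents (e ∘ f) = D.ascents f := by
  simp [ascents]

lemma descents_comp [Fintype A] {C C' : Type*} [LinearOrder C] [LinearOrder C']
    (D : MultiDigraph V A) (e : C ↪o C') (f : V → C) : D.descents (e ∘ f) = D.descents f := by
  simp [descents]

open Classical in
/-- The `B`-polynomial counts `q`-colorings by ascents and descents. -/
theorem eval_bPoly [Fintype V] [Fintype A] (D : MultiDigraph V A) (q : ℕ) (y z : ℚ) :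
    MvPolynomial.eval ![(q : ℚ), y, z] D.bPoly =
      ∑ f : V → Fin q, y ^ D.ascents f * z ^ D.descents f := by
  set F : ℕ → ℚ := fun p => ∑ g ∈ (Finset.univ.filter fun g : V → Fin p => Function.Surjective g),
    y ^ D.ascents g * z ^ D.descents g with hF
  have hbin : ∀ p : ℕ, ((p.factorial : ℚ)⁻¹) * (descPochhammer ℚ p).eval (q : ℚ) = q.choose p := by
    intro p
    rw [descPochhammer_eval_eq_descFactorial, Nat.descFactorial_eq_factorial_mul_choose]
    push_cast
    field_simp
  have hpoly : ∀ p : ℕ, MvPolynomial.eval ![(q : ℚ), y, z]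
      (Polynomial.aeval (MvPolynomial.X 0 : MvPolynomial (Fin 3) ℚ) (descPochhammer ℚ p)) =
      (descPochhammer ℚ p).eval (q : ℚ) := by
    intro p
    have h := Polynomial.hom_eval₂ (descPochhammer ℚ p)
      (algebraMap ℚ (MvPolynomial (Fin 3) ℚ)) (MvPolynomial.eval ![(q : ℚ), y, z])
      (MvPolynomial.X 0)
    rw [Polynomial.aeval_def, h]
    have : (MvPolynomial.eval ![(q : ℚ), y, z]).comp (algebraMap ℚ (MvPolynomial (Fin 3) ℚ)) =
        RingHom.id ℚ := Subsingleton.elim _ _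
    rw [this]
    simp
  have hL : MvPolynomial.eval ![(q : ℚ), y, z] D.bPoly =
      ∑ p ∈ Finset.range (Fintype.card V + 1), (q.choose p : ℚ) * F p := by
    simp only [bPoly, map_sum, map_mul, map_pow, MvPolynomial.eval_C, MvPolynomial.eval_X, hpoly,
      hbin, hF]
    rfl
  have hfib : ∀ s : Finset (Fin q),
      (∑ f ∈ (Finset.univ.filter fun f : V → Fin q => Finset.univ.image f = s),
        y ^ D.ascents f * z ^ D.descents f) = F s.card := by
    intro s
    symm
    refine Finset.sum_bij (fun g _ => s.orderEmbOfFin rfl ∘ g) ?_ ?_ ?_ ?_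
    · intro g hg
      have hg' : Function.Surjective g := by simpa using hg
      simp only [Finset.mem_filter, Finset.mem_univ, true_and]
      apply Finset.coe_injective
      rw [Finset.coe_image, Finset.coe_univ, Set.image_univ, hg'.range_comp,
        Finset.range_orderEmbOfFin]
    · intro g _ g' _ h
      exact (s.orderEmbOfFin rfl).injective.comp_left h
    · intro f hf
      have hf' : Finset.univ.image f = s := by simpa using hf
      have hr : Set.range f = s := by rw [← hf']; simp
      have hmem : ∀ v, ∃ i, s.orderEmbOfFin rfl i = f v := by
        intro v
        have : f v ∈ Set.range (s.orderEmbOfFin rfl) := by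
          rw [Finset.range_orderEmbOfFin, ← hr]; exact ⟨v, rfl⟩
        exact this
      choose g hg using hmem
      refine ⟨g, ?_, funext hg⟩
      simp only [Finset.mem_filter, Finset.mem_univ, true_and]
      intro i
      have : s.orderEmbOfFin rfl i ∈ Set.range f := by
        rw [hr]; exact Finset.orderEmbOfFin_mem s rfl i
      obtain ⟨v, hv⟩ := this
      exact ⟨v, (s.orderEmbOfFin rfl).injective ((hg v).trans hv)⟩
    · intro g _
      rw [ascents_comp, descents_comp]
  have hR : ∑ f : V → Fin q, y ^ D.ascents f * z ^ D.descents f =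
      ∑ p ∈ Finset.range (q + 1), (q.choose p : ℚ) * F p := by
    rw [← Finset.sum_fiberwise Finset.univ (fun f : V → Fin q => Finset.univ.image f)]
    simp only [hfib]
    have h := Finset.sum_powerset_apply_card F (x := (Finset.univ : Finset (Fin q)))
    simpa using h
  have hF0 : ∀ p, Fintype.card V < p → F p = 0 := by
    intro p hp
    apply Finset.sum_eq_zero
    intro g hg
    have hg' : Function.Surjective g := by simpa using hg
    have := Fintype.card_le_of_surjective g hg'
    simp at this
    omega
  rw [hL, hR]
  have h1 : ∀ N M : ℕ, N ≤ M → (∀ p, N < p → (q.choose p : ℚ) * F p = 0) →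
      ∑ p ∈ Finset.range (N + 1), (q.choose p : ℚ) * F p =
        ∑ p ∈ Finset.range (M + 1), (q.choose p : ℚ) * F p := by
    intro N M hNM h0
    apply Finset.sum_subset
    · intro p hp
      simp only [Finset.mem_range] at *
      omega
    · intro p _ hp
      apply h0
      simp only [Finset.mem_range] at hp
      omega
  rcases le_total (Fintype.card V) q with h | h
  · exact h1 _ _ h fun p hp => by rw [hF0 p hp, mul_zero]
  · exact (h1 _ _ h fun p hp => by rw [Nat.choose_eq_zero_of_lt hp]; simp).symm

open Classical in
/-- A polynomial is determined by its values at positive integers `q` and arbitrary `y, z`. -/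
theorem bPoly_unique [Fintype V] [Fintype A] (D : MultiDigraph V A) (P : MvPolynomial (Fin 3) ℚ)
    (hP : ∀ q : ℕ, 0 < q → ∀ y z : ℚ, MvPolynomial.eval ![(q : ℚ), y, z] P =
      ∑ f : V → Fin q, y ^ D.ascents f * z ^ D.descents f) : P = D.bPoly := by
  refine MvPolynomial.funext_set
    ![(fun n : ℕ => ((n + 1 : ℕ) : ℚ)) '' Set.univ, Set.univ, Set.univ] ?_ ?_
  · intro i
    fin_cases i
    · refine Set.infinite_univ.image ?_
      intro a _ b _ h
      have h' : ((a + 1 : ℕ) : ℚ) = ((b + 1 : ℕ) : ℚ) := h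
      have := Nat.cast_injective h'
      omega
    · exact Set.infinite_univ
    · exact Set.infinite_univ
  · intro x hx
    obtain ⟨n, -, hn⟩ : x 0 ∈ (fun n : ℕ => ((n + 1 : ℕ) : ℚ)) '' Set.univ := hx 0 (Set.mem_univ _)
    have hx' : x = ![((n + 1 : ℕ) : ℚ), x 1, x 2] := by
      ext i
      fin_cases i
      · exact hn.symm
      · rfl
      · rfl
    rw [hx', hP _ (Nat.succ_pos n), eval_bPoly]

/-- The number of connected components of the underlying undirected graph. -/
noncomputable def comp (D : MultiDigraph V A) : ℕ :=
  Nat.card (SimpleGraph.fromRel fun u v => ∃ a, D.origin a = u ∧ D.target a = v).ConnectedComponent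

/-- A directed cycle: a cyclic sequence of `n + 1 ≥ 1` arcs, each ending where the next one starts
(addition in `Fin (n + 1)` wraps around), without repeated vertices. A loop is a directed cycle. -/
def IsDirectedCycle (D : MultiDigraph V A) {n : ℕ} (c : Fin (n + 1) → A) : Prop :=
  Function.Injective (fun i => D.origin (c i)) ∧ ∀ i, D.target (c i) = D.origin (c (i + 1))

/-- Every arc lies in a directed cycle. -/
def IsTotallyCyclic (D : MultiDigraph V A) : Prop :=
  ∀ a : A, ∃ (n : ℕ) (c : Fin (n + 1) → A), D.IsDirectedCycle c ∧ a ∈ Set.range c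

end MultiDigraph

/-- A mixed graph: a digraph with a partition of its arc set into singletons (oriented edges) and
pairs of opposite arcs (unoriented edges). -/
structure MixedGraph (V A : Type*) [Fintype A] [DecidableEq A] extends MultiDigraph V A where
  edges : Finpartition (Finset.univ : Finset A)
  isEdge : ∀ e ∈ edges.parts, (∃ a, e = {a}) ∨
    ∃ a b, a ≠ b ∧ e = {a, b} ∧ origin b = target a ∧ target b = origin a

namespace MixedGraph

variable {V A : Type*} [Fintype V] [Fintype A] [DecidableEq A]

/-- The complete orientations of `D`, given by their arc sets: exactly one arc is kept from every
edge. The digraph itself is `D.restrict S`. -/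
def completeOrientations (D : MixedGraph V A) : Finset (Finset A) :=
  Finset.univ.filter fun S => ∀ e ∈ D.edges.parts, (S ∩ e).card = 1

/-- The field `ℚ(x, y)` of rational functions. -/
abbrev RatXY : Type := FractionRing (MvPolynomial (Fin 2) ℚ)

/-- The rational function `x`. -/
noncomputable def ratX : RatXY := algebraMap (MvPolynomial (Fin 2) ℚ) RatXY (MvPolynomial.X 0)

/-- The rational function `y`. -/
noncomputable def ratY : RatXY := algebraMap (MvPolynomial (Fin 2) ℚ) RatXY (MvPolynomial.X 1)

/-- The invariant `T⁽²⁾_D(x, y)`, as an element of `ℚ(x, y)`. -/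
noncomputable def tutteTwo (D : MixedGraph V A) : RatXY :=
  ratY ^ D.edges.parts.card /
      (2 ^ D.edges.parts.card * (ratY - 1) ^ Fintype.card V * (ratX - 1) ^ D.comp) *
    ∑ S ∈ D.completeOrientations,
      MvPolynomial.aeval ![(ratX - 1) * (ratY - 1), (2 - ratY) / ratY, 1] (D.restrict S).bPoly

/-- The rational function `r` is regular at the point `(x₀, y₀)`, with value `c` there: it is a
quotient of two polynomials whose denominator does not vanish at the point. -/
def HasValueAt (r : RatXY) (x₀ y₀ c : ℚ) : Prop :=
  ∃ f g : MvPolynomial (Fin 2) ℚ, MvPolynomial.eval ![x₀, y₀] g ≠ 0 ∧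
    r = algebraMap _ RatXY f / algebraMap _ RatXY g ∧
    c = MvPolynomial.eval ![x₀, y₀] f / MvPolynomial.eval ![x₀, y₀] g

/-- The value of a rational function at a point is unique. -/
theorem HasValueAt.unique {r : RatXY} {x₀ y₀ c c' : ℚ} (h : HasValueAt r x₀ y₀ c)
    (h' : HasValueAt r x₀ y₀ c') : c = c' := by
  obtain ⟨f, g, hg, hr, rfl⟩ := h
  obtain ⟨f', g', hg', hr', rfl⟩ := h'
  have inj : Function.Injective (algebraMap (MvPolynomial (Fin 2) ℚ) RatXY) :=
    IsFractionRing.injective _ _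
  have h0 : ∀ k : MvPolynomial (Fin 2) ℚ, MvPolynomial.eval ![x₀, y₀] k ≠ 0 →
      algebraMap (MvPolynomial (Fin 2) ℚ) RatXY k ≠ 0 := by
    intro k hk hk0
    rw [← map_zero (algebraMap (MvPolynomial (Fin 2) ℚ) RatXY)] at hk0
    rw [inj hk0] at hk
    simp at hk
  rw [hr, div_eq_div_iff (h0 g hg) (h0 g' hg'), ← map_mul, ← map_mul] at hr'
  have := congrArg (MvPolynomial.eval ![x₀, y₀]) (inj hr')
  rw [map_mul, map_mul] at this
  rwa [div_eq_div_iff hg hg']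

/-- For a polynomial, the value is the usual evaluation. -/
theorem hasValueAt_algebraMap_iff (P : MvPolynomial (Fin 2) ℚ) (x₀ y₀ c : ℚ) :
    HasValueAt (algebraMap _ RatXY P) x₀ y₀ c ↔ MvPolynomial.eval ![x₀, y₀] P = c := by
  have h : HasValueAt (algebraMap _ RatXY P) x₀ y₀ (MvPolynomial.eval ![x₀, y₀] P) :=
    ⟨P, 1, by simp, by simp, by simp⟩
  exact ⟨fun h' => h.unique h', fun h' => h' ▸ h⟩

end MixedGraph

/-! At `(x, y) = (0, 2)` the prefactor of `T⁽²⁾_D` is `(-1) ^ c(D)`, and each complete orientation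
`Γ` contributes `B_Γ(-1, 0, 1)`. The polynomial `B_Γ(q, 0, 1)` counts the maps to a `q`-chain
without ascents, that is, the monotone maps from the vertices preordered by reachability, or from
the poset of strong components. Removing the last color by inclusion-exclusion over the maximal
elements gives `Ω_P(q) = ∑ B, (-1) ^ |B| * Ω_{P \ B}(q + 1)`, where `B` runs over the
sets of maximal elements of `P`. At `q = -1` only `B = P` survives, so the value is `(-1) ^ |P|` if
`P` is an antichain and `0` otherwise. The poset of strong components is an antichain exactly when
`Γ` is totally cyclic, and its elements are then the connected components, so the signs cancel.
-/

open Polynomial Relation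

lemma eq_of_forall_eval_natCast_eq {R : Type*} [CommRing R] [IsDomain R] [CharZero R] {p q : R[X]}
    (h : ∀ n : ℕ, p.eval (n : R) = q.eval (n : R)) : p = q :=
  eq_of_infinite_eval_eq p q <|
    (Set.infinite_range_of_injective Nat.cast_injective).mono <| Set.range_subset_iff.mpr h

lemma eval_mvPolynomial_aeval {R σ : Type*} [CommSemiring R] (g : σ → R[X]) (P : MvPolynomial σ R)
    (t : R) : (MvPolynomial.aeval g P).eval t = MvPolynomial.eval (fun i ↦ (g i).eval t) P := by
  rw [MvPolynomial.aeval_def, MvPolynomial.polynomial_eval_eval₂, MvPolynomial.eval]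
  congr 1
  ext
  simp

section

variable {α : Type*} {r : α → α → Prop}

lemma exists_injOn_path_of_reflTransGen {u v : α} (h : ReflTransGen r u v) :
    ∃ (n : ℕ) (x : ℕ → α), x 0 = u ∧ x n = v ∧ (∀ i < n, r (x i) (x (i + 1))) ∧
      Set.InjOn x (Set.Iic n) := by
  induction h using ReflTransGen.head_induction_on with
  | refl =>
    exact ⟨0, fun _ ↦ v, rfl, rfl, fun i hi ↦ absurd hi i.not_lt_zero,
      fun i hi j hj _ ↦ (Nat.le_zero.mp hi).trans (Nat.le_zero.mp hj).symm⟩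
  | @head u w huw _ ih =>
    obtain ⟨n, x, rfl, hxn, hstep, hinj⟩ := ih
    by_cases hu : ∃ k ≤ n, x k = u
    · obtain ⟨k, hk, rfl⟩ := hu
      refine ⟨n - k, fun i ↦ x (k + i), rfl,
        (congrArg x (Nat.add_sub_cancel' hk)).trans hxn,
        fun i hi ↦ hstep (k + i) (by omega), fun i hi j hj hij ↦ ?_⟩
      rw [Set.mem_Iic] at hi hj
      exact Nat.add_left_cancel (hinj (Set.mem_Iic.mpr (by omega)) (Set.mem_Iic.mpr (by omega)) hij)
    · push Not at hu
      refine ⟨n + 1, fun i ↦ Nat.casesOn i u x, rfl, hxn, ?_, ?_⟩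
      · rintro (_ | i) hi
        · exact huw
        · exact hstep i (by omega)
      · rintro (_ | i) hi (_ | j) hj hij
        · rfl
        · exact absurd hij.symm (hu j (Nat.le_of_succ_le_succ hj))
        · exact absurd hij (hu i (Nat.le_of_succ_le_succ hi))
        · exact congrArg Nat.succ
            (hinj (Nat.le_of_succ_le_succ hi) (Nat.le_of_succ_le_succ hj) hij)

lemma reachable_fromRel_iff_reflTransGen (h : ∀ ⦃u v⦄, r u v → ReflTransGen r v u) {u v : α} :
    (SimpleGraph.fromRel r).Reachable u v ↔ ReflTransGen r u v := by
  rw [SimpleGraph.reachable_iff_reflTransGen]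
  refine ⟨ReflTransGen.lift' id (fun a b hab ↦ ?_) u v,
    ReflTransGen.lift' id (fun a b hab ↦ ?_) u v⟩
  · obtain ⟨-, hab | hba⟩ := (SimpleGraph.fromRel_adj r a b).mp hab
    · exact .single hab
    · exact h hba
  · rcases eq_or_ne a b with rfl | hne
    · exact .refl
    · exact .single ((SimpleGraph.fromRel_adj r a b).mpr ⟨hne, .inl hab⟩)

end

namespace MultiDigraph

variable {V A : Type*} [Fintype A]

lemma ascents_eq_zero_iff {C : Type*} [LinearOrder C] (D : MultiDigraph V A) (f : V → C) :
    D.ascents f = 0 ↔ ∀ a, f (D.target a) ≤ f (D.origin a) := by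
  simp [ascents, Finset.filter_eq_empty_iff]

variable [Fintype V]

/-- The polynomial `B_D(q, 0, 1)` in `q`; at a natural number it counts the colorings without
ascents. -/
noncomputable def ascentFreePoly (D : MultiDigraph V A) : ℚ[X] :=
  MvPolynomial.aeval ![X, 0, 1] D.bPoly

lemma eval_ascentFreePoly (D : MultiDigraph V A) (t : ℚ) :
    D.ascentFreePoly.eval t = MvPolynomial.eval ![t, 0, 1] D.bPoly := by
  rw [ascentFreePoly, eval_mvPolynomial_aeval]
  congr 2
  ext i
  fin_cases i <;> simp

lemma eval_natCast_ascentFreePoly (D : MultiDigraph V A) (q : ℕ) :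
    D.ascentFreePoly.eval (q : ℚ) =
      Nat.card {f : V → Fin q // ∀ a, f (D.target a) ≤ f (D.origin a)} := by
  classical
  rw [eval_ascentFreePoly, eval_bPoly, Nat.card_eq_fintype_card, Fintype.card_subtype]
  simp only [one_pow, mul_one, zero_pow_eq, ascents_eq_zero_iff, Finset.sum_boole]

end MultiDigraph

/-- `Ω` is the order polynomial of `P`: its value at a natural number `q` is the number of
monotone maps from `P` to a chain with `q` elements. -/
def IsOrderPolynomial (Ω : ℚ[X]) (P : Type*) [Preorder P] : Prop :=
  ∀ q : ℕ, Ω.eval (q : ℚ) = Nat.card (P →o Fin q)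

section

variable {P α : Type*}

/-- Monotone maps into a partial order factor through the antisymmetrization. -/
def orderHomAntisymmetrizationEquiv [Preorder P] [PartialOrder α] :
    (Antisymmetrization P (· ≤ ·) →o α) ≃ (P →o α) where
  toFun f := f.comp ⟨toAntisymmetrization (· ≤ ·), toAntisymmetrization_mono⟩
  invFun g :=
    { toFun := Quotient.lift g fun _ _ h ↦ (g.monotone h.1).antisymm (g.monotone h.2)
      monotone' := by
        rintro ⟨u⟩ ⟨v⟩ h
        exact g.monotone h }
  left_inv f := by
    ext ⟨v⟩
    rfl
  right_inv g := rfl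

open Classical in
/-- Prescribing the value `⊤` on an upper set puts no constraint on a monotone map elsewhere. -/
noncomputable def orderHomEqTopEquiv [Preorder P] [PartialOrder α] [OrderTop α] {U : Set P}
    (hU : IsUpperSet U) : {f : P →o α // ∀ u ∈ U, f u = ⊤} ≃ ((Uᶜ : Set P) →o α) where
  toFun f := f.1.comp (OrderHom.Subtype.val (· ∈ Uᶜ))
  invFun g :=
    { val.toFun v := if h : v ∈ U then ⊤ else g ⟨v, h⟩
      val.monotone' u v huv := by
        by_cases hv : v ∈ U
        · simp [hv]
        · have hu : u ∉ U := fun hu ↦ hv (hU huv hu)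
          simpa [hu, hv] using g.monotone huv
      property u hu := dif_pos hu }
  left_inv f := by
    ext v
    by_cases hv : v ∈ U
    · simp [hv, f.2 v hv]
    · simp [hv]
  right_inv g := by
    ext ⟨v, hv⟩
    exact dif_neg hv

/-- Monotone maps that avoid the last color use one color less. -/
def orderHomNeLastEquiv [Preorder P] (q : ℕ) :
    {f : P →o Fin (q + 1) // ∀ v, f v ≠ Fin.last q} ≃ (P →o Fin q) where
  toFun f := ⟨fun v ↦ (f.1 v).castPred (f.2 v), fun u v h ↦ by simpa using f.1.monotone h⟩
  invFun g := ⟨Fin.castSuccOrderEmb.toOrderHom.comp g, fun v ↦ (Fin.castSucc_lt_last (g v)).ne⟩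
  left_inv f := by
    ext
    rfl
  right_inv g := by
    ext
    rfl

/-- A monotone map avoids the last color as soon as it does so on the maximal elements, so this is
inclusion-exclusion over the set `B` of maximal elements that get the last color. -/
lemma card_orderHom_fin_eq_sum [Fintype P] [PartialOrder P] [DecidablePred (IsMax : P → Prop)]
    (q : ℕ) :
    (Nat.card (P →o Fin q) : ℤ) = ∑ B ∈ (Finset.univ.filter (IsMax : P → Prop)).powerset,
      (-1 : ℤ) ^ B.card * Nat.card (((B : Set P)ᶜ : Set P) →o Fin (q + 1)) := by
  classical
  have : Finite (P →o Fin (q + 1)) := DFunLike.finite _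
  have := Fintype.ofFinite (P →o Fin (q + 1))
  let M : Finset P := Finset.univ.filter IsMax
  let S (v : P) : Finset (P →o Fin (q + 1)) := Finset.univ.filter fun f ↦ f v = Fin.last q
  have avoid_iff (f : P →o Fin (q + 1)) : f ∈ M.inf (fun v ↦ (S v)ᶜ) ↔ ∀ v, f v ≠ Fin.last q := by
    simp only [Finset.mem_inf, Finset.mem_compl, Finset.mem_filter, Finset.mem_univ, true_and, M, S]
    refine ⟨fun h v hv ↦ ?_, fun h v _ ↦ h v⟩
    obtain ⟨m, hvm, hm⟩ := Finite.exists_le_maximal (p := fun _ : P ↦ True) (a := v) trivial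
    exact h m (maximal_true.mp hm) (Fin.last_le_iff.mp (hv ▸ f.monotone hvm))
  have card_avoid : Nat.card (P →o Fin q) = (M.inf fun v ↦ (S v)ᶜ).card := by
    rw [← Nat.card_congr (orderHomNeLastEquiv q), ← Nat.card_eq_finsetCard]
    exact Nat.card_congr (Equiv.subtypeEquivRight fun f ↦ (avoid_iff f).symm)
  rw [card_avoid, Finset.inclusion_exclusion_card_inf_compl]
  refine Finset.sum_congr rfl fun B hB ↦ ?_
  have isUpperSet_B : IsUpperSet (B : Set P) := fun u v huv hu ↦
    (Finset.mem_filter.mp (Finset.mem_powerset.mp hB hu)).2.eq_of_le huv ▸ hu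
  rw [← Nat.card_congr (orderHomEqTopEquiv isUpperSet_B)]
  have prescribe_iff (f : P →o Fin (q + 1)) : (∀ u ∈ (B : Set P), f u = ⊤) ↔ f ∈ B.inf S := by
    simp [S, Finset.mem_inf, Fin.top_eq_last]
  rw [Nat.card_congr (Equiv.subtypeEquivRight prescribe_iff), Nat.card_eq_finsetCard]

end

namespace IsOrderPolynomial

lemma exists_of_finite (P : Type*) [Preorder P] [Finite P] : ∃ Ω, IsOrderPolynomial Ω P := by
  classical
  have := Fintype.ofFinite P
  let D : MultiDigraph P {p : P × P // p.2 ≤ p.1} := ⟨fun a ↦ a.1.1, fun a ↦ a.1.2⟩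
  refine ⟨D.ascentFreePoly, fun q ↦ ?_⟩
  rw [D.eval_natCast_ascentFreePoly]
  exact congrArg _ <| Nat.card_congr
    { toFun f := ⟨f.1, fun u v h ↦ f.2 ⟨(v, u), h⟩⟩
      invFun f := ⟨f, fun a ↦ f.monotone a.2⟩ }

variable {P : Type*} {Ω : ℚ[X]}

lemma eval_zero [Preorder P] [Decidable (IsEmpty P)] (h : IsOrderPolynomial Ω P) :
    Ω.eval 0 = if IsEmpty P then 1 else 0 := by
  have h₀ : Ω.eval 0 = Nat.card (P →o Fin 0) := by simpa using h 0
  rw [h₀]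
  split_ifs with hP
  · have : Unique (P →o Fin 0) :=
      { default := ⟨isEmptyElim, isEmptyElim⟩
        uniq := fun f ↦ OrderHom.ext _ _ (Subsingleton.elim _ _) }
    simp
  · obtain ⟨v⟩ := not_isEmpty_iff.mp hP
    have : IsEmpty (P →o Fin 0) := ⟨fun f ↦ (f v).elim0⟩
    simp

lemma antisymmetrization [Preorder P] (h : IsOrderPolynomial Ω P) :
    IsOrderPolynomial Ω (Antisymmetrization P (· ≤ ·)) := fun q ↦ by
  rw [h q, Nat.card_congr orderHomAntisymmetrizationEquiv]

lemma eq_sum_comp [Fintype P] [PartialOrder P] [DecidablePred (IsMax : P → Prop)]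
    (h : IsOrderPolynomial Ω P) {Ω' : Finset P → ℚ[X]}
    (h' : ∀ B, IsOrderPolynomial (Ω' B) ((B : Set P)ᶜ : Set P)) :
    Ω = ∑ B ∈ (Finset.univ.filter (IsMax : P → Prop)).powerset,
      (-1) ^ B.card * (Ω' B).comp (X + 1) := by
  refine eq_of_forall_eval_natCast_eq fun q ↦ ?_
  have hshift (B : Finset P) : ((Ω' B).comp (X + 1)).eval (q : ℚ) =
      Nat.card (((B : Set P)ᶜ : Set P) →o Fin (q + 1)) := by
    simpa using h' B (q + 1)
  simp only [h q, eval_finsetSum, eval_mul, eval_pow, eval_neg, eval_one, hshift]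
  simpa using congrArg (Int.cast : ℤ → ℚ) (card_orderHom_fin_eq_sum (P := P) q)

lemma eval_neg_one_of_partialOrder [Finite P] [PartialOrder P]
    [Decidable (∀ v : P, IsMax v)] (h : IsOrderPolynomial Ω P) :
    Ω.eval (-1) = if ∀ v : P, IsMax v then (-1) ^ Nat.card P else 0 := by
  classical
  have := Fintype.ofFinite P
  choose Ω' hΩ' using fun B : Finset P ↦ exists_of_finite ((B : Set P)ᶜ : Set P)
  have hterm (B : Finset P) : ((-1) ^ B.card * (Ω' B).comp (X + 1)).eval (-1) =
      if B = Finset.univ then (-1) ^ B.card else (0 : ℚ) := by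
    have hB : IsEmpty ((B : Set P)ᶜ : Set P) ↔ B = Finset.univ := by
      rw [Set.isEmpty_coe_sort, Set.compl_empty_iff, Finset.coe_eq_univ]
    simp [(hΩ' B).eval_zero, hB]
  rw [h.eq_sum_comp hΩ', eval_finsetSum]
  simp only [hterm, Finset.sum_ite_eq', Finset.mem_powerset, Finset.univ_subset_iff,
    Finset.filter_eq_self, Finset.mem_univ, forall_const, Finset.card_univ,
    Nat.card_eq_fintype_card]

theorem eval_neg_one [Finite P] [Preorder P] [Decidable (∀ v : P, IsMax v)]
    (h : IsOrderPolynomial Ω P) :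
    Ω.eval (-1) =
      if ∀ v : P, IsMax v then (-1) ^ Nat.card (Antisymmetrization P (· ≤ ·)) else 0 := by
  classical
  have : Finite (Antisymmetrization P (· ≤ ·)) := Quotient.finite _
  have hmax : (∀ c : Antisymmetrization P (· ≤ ·), IsMax c) ↔ ∀ v : P, IsMax v :=
    ⟨fun hc u v huv ↦ hc (toAntisymmetrization _ u) (b := toAntisymmetrization _ v) huv, by
      rintro hv ⟨u⟩ ⟨v⟩ huv
      exact hv u huv⟩
  rw [h.antisymmetrization.eval_neg_one_of_partialOrder]
  simp only [hmax]

end IsOrderPolynomial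

namespace MultiDigraph

variable {V A : Type*}

/-- The arc relation of a digraph. -/
def IsArc (D : MultiDigraph V A) (u v : V) : Prop := ∃ a, D.origin a = u ∧ D.target a = v

/-- The vertices of `D`, preordered by reachability. The direction of the order is chosen so that
the colorings without ascents are the monotone ones. -/
def ReachOrder (_D : MultiDigraph V A) : Type _ := V

instance (D : MultiDigraph V A) : Preorder D.ReachOrder where
  le u v := ReflTransGen D.IsArc v u
  le_refl _ := .refl
  le_trans _ _ _ huv hvw := hvw.trans huv

instance (D : MultiDigraph V A) [h : Finite V] : Finite D.ReachOrder := h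

lemma monotone_reachOrder_iff {α : Type*} [Preorder α] (D : MultiDigraph V A)
    (f : D.ReachOrder → α) : Monotone f ↔ ∀ a, f (D.target a) ≤ f (D.origin a) := by
  refine ⟨fun hf a ↦ hf (.single ⟨a, rfl, rfl⟩), fun hf u v hvu ↦ ?_⟩
  induction hvu with
  | refl => exact le_rfl
  | tail _ harc ih =>
    obtain ⟨a, rfl, rfl⟩ := harc
    exact (hf a).trans ih

lemma isOrderPolynomial_ascentFreePoly [Fintype V] [Fintype A] (D : MultiDigraph V A) :
    IsOrderPolynomial D.ascentFreePoly D.ReachOrder := fun q ↦ by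
  rw [D.eval_natCast_ascentFreePoly]
  exact congrArg _ <| Nat.card_congr
    { toFun f := ⟨f.1, (D.monotone_reachOrder_iff f.1).mpr f.2⟩
      invFun f := ⟨f, (D.monotone_reachOrder_iff f).mp f.monotone⟩ }

open Fin.NatCast in
lemma IsDirectedCycle.reflTransGen {D : MultiDigraph V A} {n : ℕ} {c : Fin (n + 1) → A}
    (hc : D.IsDirectedCycle c) (i : Fin (n + 1)) :
    ReflTransGen D.IsArc (D.target (c i)) (D.origin (c i)) := by
  have walk (j : Fin (n + 1)) (k : ℕ) :
      ReflTransGen D.IsArc (D.origin (c j)) (D.origin (c (j + (k : Fin (n + 1))))) := by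
    induction k with
    | zero => simpa using ReflTransGen.refl
    | succ k ih =>
      refine ih.tail ⟨c (j + (k : Fin (n + 1))), rfl, ?_⟩
      rw [hc.2, Nat.cast_succ, add_assoc]
  have hwrap : i + 1 + (n : Fin (n + 1)) = i := by
    rw [add_assoc, add_comm 1, ← Nat.cast_succ, Fin.natCast_self, add_zero]
  simpa only [hc.2, hwrap] using walk (i + 1) n

lemma exists_isDirectedCycle_of_reflTransGen (D : MultiDigraph V A) (a : A)
    (h : ReflTransGen D.IsArc (D.target a) (D.origin a)) :
    ∃ (n : ℕ) (c : Fin (n + 1) → A), D.IsDirectedCycle c ∧ a ∈ Set.range c := by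
  obtain ⟨n, x, hx₀, hxn, hstep, hinj⟩ := exists_injOn_path_of_reflTransGen h
  choose w hw using fun i : Fin n ↦ hstep i i.2
  let c : Fin (n + 1) → A := Fin.snoc w a
  have horigin (i : Fin (n + 1)) : D.origin (c i) = x i := by
    refine Fin.lastCases ?_ (fun j ↦ ?_) i
    · simp [c, hxn]
    · simp [c, (hw j).1]
  refine ⟨n, c, ⟨fun i j hij ↦ ?_, fun i ↦ ?_⟩, Fin.last n, by simp [c]⟩
  · simp only [horigin] at hij
    exact Fin.ext (hinj (Nat.le_of_lt_succ i.2) (Nat.le_of_lt_succ j.2) hij)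
  · rw [horigin]
    refine Fin.lastCases ?_ (fun j ↦ ?_) i
    · simp [c, hx₀]
    · simp [c, (hw j).2, Fin.coeSucc_eq_succ]

lemma isTotallyCyclic_iff_reflTransGen (D : MultiDigraph V A) :
    D.IsTotallyCyclic ↔ ∀ a, ReflTransGen D.IsArc (D.target a) (D.origin a) := by
  refine ⟨fun h a ↦ ?_, fun h a ↦ D.exists_isDirectedCycle_of_reflTransGen a (h a)⟩
  obtain ⟨n, c, hc, i, rfl⟩ := h a
  exact hc.reflTransGen i

lemma isTotallyCyclic_iff_forall_isMax (D : MultiDigraph V A) :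
    D.IsTotallyCyclic ↔ ∀ v : D.ReachOrder, IsMax v := by
  rw [isTotallyCyclic_iff_reflTransGen]
  refine ⟨fun h v u hvu ↦ ?_, fun h a ↦ h (D.target a) (.single ⟨a, rfl, rfl⟩)⟩
  induction hvu with
  | refl => exact .refl
  | tail _ harc ih =>
    obtain ⟨a, rfl, rfl⟩ := harc
    exact (h a).trans ih

lemma IsTotallyCyclic.card_antisymmetrization {D : MultiDigraph V A} (hD : D.IsTotallyCyclic) :
    Nat.card (Antisymmetrization D.ReachOrder (· ≤ ·)) = D.comp := by
  have hmax := D.isTotallyCyclic_iff_forall_isMax.mp hD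
  have harc ⦃u v : V⦄ (h : D.IsArc u v) : ReflTransGen D.IsArc v u := hmax v (.single h)
  refine Nat.card_congr (Quot.congrRight fun u v ↦ ?_)
  exact ⟨fun h ↦ (reachable_fromRel_iff_reflTransGen harc).mpr h.2, fun h ↦
    have huv : v ≤ u := (reachable_fromRel_iff_reflTransGen harc).mp h
    ⟨hmax v huv, huv⟩⟩

theorem eval_bPoly_neg_one_zero_one [Fintype V] [Fintype A] (D : MultiDigraph V A)
    [Decidable D.IsTotallyCyclic] :
    MvPolynomial.eval ![-1, 0, 1] D.bPoly = if D.IsTotallyCyclic then (-1) ^ D.comp else 0 := by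
  classical
  rw [← eval_ascentFreePoly, D.isOrderPolynomial_ascentFreePoly.eval_neg_one]
  simp only [← isTotallyCyclic_iff_forall_isMax]
  split_ifs with hD
  · rw [hD.card_antisymmetrization]
  · rfl

/-- The unordered pair of ends of an arc. -/
def ends (D : MultiDigraph V A) (a : A) : Sym2 V := s(D.origin a, D.target a)

lemma mem_range_ends (D : MultiDigraph V A) (u v : V) :
    s(u, v) ∈ Set.range D.ends ↔ D.IsArc u v ∨ D.IsArc v u := by
  simp only [Set.mem_range, ends, Sym2.eq_iff, exists_or, IsArc]

lemma comp_eq_of_range_ends_eq {A' : Type*} {D : MultiDigraph V A} {D' : MultiDigraph V A'}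
    (h : Set.range D.ends = Set.range D'.ends) : D.comp = D'.comp := by
  have hgraph : SimpleGraph.fromRel D.IsArc = SimpleGraph.fromRel D'.IsArc := by
    ext u v
    rw [SimpleGraph.fromRel_adj, SimpleGraph.fromRel_adj, ← mem_range_ends, h, mem_range_ends]
  exact congrArg (fun G : SimpleGraph V ↦ Nat.card G.ConnectedComponent) hgraph

end MultiDigraph

namespace MixedGraph

namespace HasValueAt

variable {r s : RatXY} {x₀ y₀ c d : ℚ}

lemma add (hr : HasValueAt r x₀ y₀ c) (hs : HasValueAt s x₀ y₀ d) :
    HasValueAt (r + s) x₀ y₀ (c + d) := by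
  obtain ⟨f, g, hg, rfl, rfl⟩ := hr
  obtain ⟨f', g', hg', rfl, rfl⟩ := hs
  have hne {k : MvPolynomial (Fin 2) ℚ} (hk : MvPolynomial.eval ![x₀, y₀] k ≠ 0) :
      algebraMap _ RatXY k ≠ 0 := by
    rw [Ne, FaithfulSMul.algebraMap_eq_zero_iff]
    rintro rfl
    exact hk (map_zero _)
  refine ⟨f * g' + g * f', g * g', by simp [hg, hg'], ?_, ?_⟩
  · rw [div_add_div _ _ (hne hg) (hne hg')]
    simp only [map_add, map_mul]
  · rw [div_add_div _ _ hg hg']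
    simp only [map_add, map_mul]

lemma mul (hr : HasValueAt r x₀ y₀ c) (hs : HasValueAt s x₀ y₀ d) :
    HasValueAt (r * s) x₀ y₀ (c * d) := by
  obtain ⟨f, g, hg, rfl, rfl⟩ := hr
  obtain ⟨f', g', hg', rfl, rfl⟩ := hs
  exact ⟨f * f', g * g', by simp [hg, hg'], by simp only [div_mul_div_comm, map_mul],
    by simp only [div_mul_div_comm, map_mul]⟩

lemma aeval {σ : Type*} {r : σ → RatXY} {c : σ → ℚ} (h : ∀ i, HasValueAt (r i) x₀ y₀ (c i))
    (P : MvPolynomial σ ℚ) :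
    HasValueAt (MvPolynomial.aeval r P) x₀ y₀ (MvPolynomial.eval c P) := by
  induction P using MvPolynomial.induction_on with
  | C a =>
    rw [MvPolynomial.aeval_C, MvPolynomial.eval_C,
      IsScalarTower.algebraMap_apply ℚ (MvPolynomial (Fin 2) ℚ), hasValueAt_algebraMap_iff,
      MvPolynomial.algebraMap_eq, MvPolynomial.eval_C]
  | add p q hp hq => simpa only [map_add] using hp.add hq
  | mul_X p i hp =>
    simpa only [map_mul, MvPolynomial.aeval_X, MvPolynomial.eval_X] using hp.mul (h i)

lemma sum {ι : Type*} (t : Finset ι) {r : ι → RatXY} {c : ι → ℚ}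
    (h : ∀ i, HasValueAt (r i) x₀ y₀ (c i)) :
    HasValueAt (∑ i ∈ t, r i) x₀ y₀ (∑ i ∈ t, c i) := by
  simpa only [map_sum, MvPolynomial.aeval_X, MvPolynomial.eval_X] using
    aeval h (∑ i ∈ t, MvPolynomial.X i)

end HasValueAt

variable {V A : Type*} [Fintype A] [DecidableEq A]

lemma hasValueAt_tutteTwo_prefactor (m n k : ℕ) :
    HasValueAt (ratY ^ m / (2 ^ m * (ratY - 1) ^ n * (ratX - 1) ^ k)) 0 2 ((-1) ^ k) := by
  refine ⟨.X 1 ^ m, 2 ^ m * (.X 1 - 1) ^ n * (.X 0 - 1) ^ k, by norm_num, ?_, ?_⟩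
  · simp [ratX, ratY, map_ofNat]
  · rcases neg_one_pow_eq_or ℚ k with h | h <;> norm_num [h]

lemma hasValueAt_aeval_bPoly [Fintype V] {B : Type*} [Fintype B] (D : MultiDigraph V B) :
    HasValueAt (MvPolynomial.aeval ![(ratX - 1) * (ratY - 1), (2 - ratY) / ratY, 1] D.bPoly) 0 2
      (MvPolynomial.eval ![-1, 0, 1] D.bPoly) := by
  refine HasValueAt.aeval (fun i ↦ ?_) _
  fin_cases i
  · exact ⟨(.X 0 - 1) * (.X 1 - 1), 1, by simp, by simp [ratX, ratY], by norm_num⟩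
  · exact ⟨2 - .X 1, .X 1, by simp, by simp [ratY, map_ofNat], by norm_num⟩
  · exact ⟨1, 1, by simp, by simp, by simp⟩

lemma hasValueAt_tutteTwo [Fintype V] (D : MixedGraph V A) :
    HasValueAt D.tutteTwo 0 2 ((-1) ^ D.comp *
      ∑ S ∈ D.completeOrientations, MvPolynomial.eval ![-1, 0, 1] (D.restrict S).bPoly) :=
  (hasValueAt_tutteTwo_prefactor _ _ _).mul (.sum _ fun S ↦ hasValueAt_aeval_bPoly (D.restrict S))

lemma ends_eq_of_mem_part (D : MixedGraph V A) {e : Finset A} (he : e ∈ D.edges.parts) {a b : A}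
    (ha : a ∈ e) (hb : b ∈ e) : D.ends a = D.ends b := by
  obtain ⟨c, rfl⟩ | ⟨c, d, -, rfl, horigin, htarget⟩ := D.isEdge e he
  · rw [Finset.mem_singleton.mp ha, Finset.mem_singleton.mp hb]
  · have hcd : D.ends c = D.ends d := by
      rw [MultiDigraph.ends, MultiDigraph.ends, horigin, htarget, Sym2.eq_swap]
    rw [Finset.mem_insert, Finset.mem_singleton] at ha hb
    obtain rfl | rfl := ha <;> obtain rfl | rfl := hb <;> simp only [hcd]

lemma comp_restrict (D : MixedGraph V A) {S : Finset A} (hS : S ∈ D.completeOrientations) :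
    (D.restrict S).comp = D.comp := by
  refine MultiDigraph.comp_eq_of_range_ends_eq (subset_antisymm ?_ ?_)
  · rintro _ ⟨a, rfl⟩
    exact ⟨a, rfl⟩
  · rintro _ ⟨a, rfl⟩
    obtain ⟨e, he, hae⟩ := D.edges.exists_mem (Finset.mem_univ a)
    have hcard : (S ∩ e).card = 1 := (Finset.mem_filter.mp hS).2 e he
    obtain ⟨b, hb⟩ := Finset.card_pos.mp (hcard ▸ Nat.one_pos)
    obtain ⟨hbS, hbe⟩ := Finset.mem_inter.mp hb
    exact ⟨⟨b, hbS⟩, D.ends_eq_of_mem_part he hbe hae⟩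

end MixedGraph

theorem corollary7p4 {V A : Type*} [Fintype V] [Fintype A] [DecidableEq A] (D : MixedGraph V A) :
    MixedGraph.HasValueAt D.tutteTwo 0 2
      ({S : Finset A | S ∈ D.completeOrientations ∧ (D.restrict S).IsTotallyCyclic}.ncard : ℚ) := by
  classical
  convert D.hasValueAt_tutteTwo using 1
  have hncard : {S | S ∈ D.completeOrientations ∧ (D.restrict S).IsTotallyCyclic}.ncard =
      (D.completeOrientations.filter fun S ↦ (D.restrict S).IsTotallyCyclic).card := by
    rw [← Set.ncard_coe_finset, Finset.coe_filter]
  rw [hncard, ← Finset.sum_boole, Finset.mul_sum]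
  refine Finset.sum_congr rfl fun S hS ↦ ?_
  rw [MultiDigraph.eval_bPoly_neg_one_zero_one, D.comp_restrict hS, mul_ite, mul_zero, ← mul_pow,
    neg_one_mul, neg_neg, one_pow]
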